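/- **Setting.** Let $\mathcal G$ be an undirected connected graph on $\{1,\dots,N\}$ with symmetric weights $a_{ij}=a_{ji}$, where $a_{ij}>0$ if $ij$ is an edge and $a_{ij}=0$ otherwise. Let $d_i\in\mathbb R^n$, let $g_i:\mathbb R^n\to\mathbb R^n$ be arbitrary functions, and let $f_i:\mathbb R^n\to\mathbb R$ be continuously differentiable and strongly convex with $l$-Lipschitz gradient. Let $X^*\in\mathbb R^{Nn}$ be a minimizer of $\sum_i f_i(x_i)$ subject to $\sum_i x_i=\sum_i d_i$. All norms are Euclidean (operator norms for derivatives). For attack signals $u_i^a,\lambda_i^a,z_i^a:[0,\infty)\to\mathbb R^n$ put $\kappa_{i1}=u_i^a$, $\kappa_{i2}=-\sum_j a_{ij}(\lambda_i^a-\lambda_j^a)-\sum_j a_{ij}(z_i^a-z_j^a)$, $\kappa_{i3}=\sum_j a_{ij}(\lambda_i^a-\lambda_j^a)$. Given functions $h_1,h_2:\mathbb R^{3n}\to\mathbb R^{3n}$ and $w_0>0$, consider, for $t\ge 0$ and $i=1,\dots,N$, the resilient algorithm $$\begin{aligned}\dot x_i&=g_i(x_i)-\nabla f_i(x_i)-\lambda_i+\kappa_{i1}-\hat\kappa_i^{(1)},\\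 \dot\lambda_i&=-\sum_j a_{ij}(\lambda_i-\lambda_j)-\sum_j a_{ij}(z_i-z_j)+x_i-d_i+\kappa_{i2}-\hat\kappa_i^{(2)},\\ \dot z_i&=\sum_j a_{ij}(\lambda_i-\lambda_j)+\kappa_{i3}-\hat\kappa_i^{(3)},\end{aligned}$$ coupled to the extended state observer with gains $a_1=w_0$, $a_2=w_0^2$, $$\dot{\hat\gamma}_i=\hat\kappa_i+u_{io}+w_0h_1(\gamma_i-\hat\gamma_i),\qquad \dot{\hat\kappa}_i=w_0^2h_2(\gamma_i-\hat\gamma_i),$$ where $\gamma_i=\mathrm{col}(x_i,\lambda_i,z_i)$, $\hat\gamma_i,\hat\kappa_i=\mathrm{col}(\hat\kappa_i^{(1)},\hat\kappa_i^{(2)},\hat\kappa_i^{(3)})\in\mathbb R^{3n}$ (so $\hat\kappa_i$ estimates $\mathrm{col}(\kappa_{i1}+g_i(x_i),\kappa_{i2},\kappa_{i3})$) and $$u_{io}=\begin{bmatrix}-\nabla f_i(x_i)-\lambda_i-\hat\kappa_i^{(1)}\\ -\sum_j a_{ij}(\lambda_i-\lambda_j)-\sum_j a_{ij}(z_i-z_j)+x_i-d_i-\hat\kappa_i^{(2)}\\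 \sum_j a_{ij}(\lambda_i-\lambda_j)-\hat\kappa_i^{(3)}\end{bmatrix}.$$ **Lyapunov assumption on $h_1,h_2$.** There exist constants $l_1,\dots,l_5>0$ and continuously differentiable $V_1,W_1:\mathbb R^{6n}\to\mathbb R$ such that for all $\eta=\mathrm{col}(\eta_1,\eta_2)$, $\eta_1,\eta_2\in\mathbb R^{3n}$: 1. $l_1\|\eta\|^2\le V_1(\eta)\le l_2\|\eta\|^2$ and $l_3\|\eta\|^2\le W_1(\eta)\le l_4\|\eta\|^2$; 2. $\frac{\partial V_1}{\partial\eta_1}(\eta)\,(\eta_2-h_1(\eta_1))-\frac{\partial V_1}{\partial\eta_2}(\eta)\,h_2(\eta_1)\le -W_1(\eta)$; 3. $\left\|\frac{\partial V_1}{\partial\eta_2}(\eta)\right\|\le l_5\|\eta\|$. **Theorem.** Under these assumptions, for every $D$ there is a constant $C$ such that the following holds for every $w_0>0$. Let $u_i^a,\lambda_i^a,z_i^a$ be differentiable attack signals which, together with their time derivatives, are bounded by $D$ on $[0,\infty)$, and consider any solution of the coupled system on $[0,\infty)$ for which each $t\mapsto g_i(x_i(t))$ is differentiable on $[0,\infty)$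 with derivative bounded by $D$ for all sufficiently large $t$. Then $X(t)=\mathrm{col}(x_1(t),\dots,x_N(t))$ is such that $\|X(t)-X^*\|$ is bounded for large $t$, and $$\limsup_{t\to\infty}\|X(t)-X^*\|\le \frac{C}{w_0}.$$ That is, $\limsup_{t\to\infty}\|X(t)-X^*\|=O(1/w_0)$, with a constant independent of $w_0$, of the initial data, and of the particular attack obeying the bound $D$. -/

import Mathlib

open Set Filter Topology
open scoped NNReal

/-- `ℝⁿ` with the Euclidean norm. -/
abbrev Vec (n : ℕ) : Type := EuclideanSpace ℝ (Fin n)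

/-- `ℝ^{kn}` with the Euclidean norm; entry `(i, j)` is coordinate `j` of block `i`. -/
abbrev Stack (k n : ℕ) : Type := EuclideanSpace ℝ (Fin k × Fin n)

/-- `col(v₁, …, v_k)` for blocks `v_i ∈ ℝⁿ`. -/
noncomputable def col {k n : ℕ} (v : Fin k → Vec n) : Stack k n :=
  WithLp.toLp 2 (fun p => v p.1 p.2)

/-- The `i`-th block of a stacked vector. -/
noncomputable def block {k n : ℕ} (X : Stack k n) (i : Fin k) : Vec n :=
  WithLp.toLp 2 (fun j => X (i, j))

/-- `col(η₁, η₂)` with `η₁, η₂ ∈ ℝ^{3n}`, i.e. `ℝ^{6n}` with the Euclidean norm. -/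
abbrev ErrSpace (n : ℕ) : Type := WithLp 2 (Stack 3 n × Stack 3 n)

/-- Data of the multi-agent system: costs `f i`, resources `d i`, inherent dynamics `g i`,
and the weights `a i j` of the communication graph. -/
structure AgentSystem (N n : ℕ) where
  f : Fin N → Vec n → ℝ
  d : Fin N → Vec n
  g : Fin N → Vec n → Vec n
  a : Matrix (Fin N) (Fin N) ℝ

/-- False data: the attack on the actuator of agent `i`, and the attacks on the transmitted
values of `λ i` and `z i`, as functions of time. -/
structure Attack (N n : ℕ) where
  u : Fin N → ℝ → Vec n
  lam : Fin N → ℝ → Vec n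
  z : Fin N → ℝ → Vec n

/-- The state curves of the closed loop: `x i`, `λ i`, `z i` and the observer states
`γ̂ i`, `κ̂ i`.  The first block of `κ̂ i` is the estimate of attack plus inherent dynamics. -/
structure Trajectory (N n : ℕ) where
  x : Fin N → ℝ → Vec n
  lam : Fin N → ℝ → Vec n
  z : Fin N → ℝ → Vec n
  gammaHat : Fin N → ℝ → Stack 3 n
  kappaHat : Fin N → ℝ → Stack 3 n

/-- `a` is a symmetric matrix of weights, positive exactly on the edges of `G`. -/
def IsWeighting {N : ℕ} (G : SimpleGraph (Fin N)) (a : Matrix (Fin N) (Fin N) ℝ) : Prop :=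
  a.IsSymm ∧ (∀ i j, G.Adj i j → 0 < a i j) ∧ (∀ i j, ¬ G.Adj i j → a i j = 0)

/-- `f` is continuously differentiable and strongly convex with `l`-Lipschitz gradient. -/
def IsRegularCost {n : ℕ} (l : ℝ≥0) (f : Vec n → ℝ) : Prop :=
  ContDiff ℝ 1 f ∧ (∃ m : ℝ, 0 < m ∧ StrongConvexOn univ m f) ∧ LipschitzWith l (gradient f)

namespace AgentSystem

variable {N n : ℕ}

/-- The feasible allocations: `∑ x i = ∑ d i`. -/
def feasible (S : AgentSystem N n) : Set (Stack N n) :=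
  {X | ∑ i, block X i = ∑ i, S.d i}

/-- `X` minimizes `∑ f i (x i)` over the feasible allocations. -/
def IsOptimal (S : AgentSystem N n) (X : Stack N n) : Prop :=
  X ∈ S.feasible ∧ IsMinOn (fun Y : Stack N n => ∑ i, S.f i (block Y i)) S.feasible X

/-- The weighted disagreement `∑ j, a i j (v i - v j)` of agent `i` with its neighbors. -/
noncomputable def disagree (S : AgentSystem N n) (v : Fin N → Vec n) (i : Fin N) : Vec n :=
  ∑ j, S.a i j • (v i - v j)

/-- `κ_{i1} = u_i^a`. -/
def kappa1 (A : Attack N n) (i : Fin N) (t : ℝ) : Vec n := A.u i t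

/-- `κ_{i2} = -∑ j a_{ij} (λ_i^a - λ_j^a) - ∑ j a_{ij} (z_i^a - z_j^a)`. -/
noncomputable def kappa2 (S : AgentSystem N n) (A : Attack N n) (i : Fin N) (t : ℝ) : Vec n :=
  -S.disagree (fun j => A.lam j t) i - S.disagree (fun j => A.z j t) i

/-- `κ_{i3} = ∑ j a_{ij} (λ_i^a - λ_j^a)`. -/
noncomputable def kappa3 (S : AgentSystem N n) (A : Attack N n) (i : Fin N) (t : ℝ) : Vec n :=
  S.disagree (fun j => A.lam j t) i

/-- `γ_i = col(x_i, λ_i, z_i)`. -/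
noncomputable def gamma (T : Trajectory N n) (i : Fin N) (t : ℝ) : Stack 3 n :=
  col ![T.x i t, T.lam i t, T.z i t]

/-- The known input `u_{io}` of the observer of agent `i`. -/
noncomputable def observerInput (S : AgentSystem N n) (T : Trajectory N n) (i : Fin N) (t : ℝ) :
    Stack 3 n :=
  col ![-gradient (S.f i) (T.x i t) - T.lam i t - block (T.kappaHat i t) 0,
     -S.disagree (fun j => T.lam j t) i - S.disagree (fun j => T.z j t) i
        + T.x i t - S.d i - block (T.kappaHat i t) 1,
     S.disagree (fun j => T.lam j t) i - block (T.kappaHat i t) 2]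

/-- The resilient distributed resource allocation algorithm under attack, for `t ≥ 0`
(one-sided derivative at `t = 0`). -/
def SolvesResilient (S : AgentSystem N n) (A : Attack N n) (T : Trajectory N n) : Prop :=
  ∀ i, ∀ t, 0 ≤ t →
    HasDerivWithinAt (T.x i)
      (S.g i (T.x i t) - gradient (S.f i) (T.x i t) - T.lam i t
        + kappa1 A i t - block (T.kappaHat i t) 0) (Ici 0) t ∧
    HasDerivWithinAt (T.lam i)
      (-S.disagree (fun j => T.lam j t) i - S.disagree (fun j => T.z j t) i
        + T.x i t - S.d i + S.kappa2 A i t - block (T.kappaHat i t) 1) (Ici 0) t ∧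
    HasDerivWithinAt (T.z i)
      (S.disagree (fun j => T.lam j t) i + S.kappa3 A i t - block (T.kappaHat i t) 2) (Ici 0) t

/-- The innovation `γ_i - γ̂_i`. -/
noncomputable def innovation (T : Trajectory N n) (i : Fin N) (t : ℝ) : Stack 3 n :=
  gamma T i t - T.gammaHat i t

/-- The extended state observer with gains `a₁, a₂` and correction functions `h₁, h₂`. -/
def SolvesESO (S : AgentSystem N n) (h₁ h₂ : Stack 3 n → Stack 3 n) (a₁ a₂ : ℝ)
    (T : Trajectory N n) : Prop :=
  ∀ i, ∀ t, 0 ≤ t →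
    HasDerivWithinAt (T.gammaHat i)
      (T.kappaHat i t + S.observerInput T i t + a₁ • h₁ (innovation T i t)) (Ici 0) t ∧
    HasDerivWithinAt (T.kappaHat i)
      (a₂ • h₂ (innovation T i t)) (Ici 0) t

/-- The inherent dynamics `t ↦ g_i(x_i(t))` has a time derivative along the trajectory, which
is bounded by `D` for all large `t`. -/
def DriftRateBound (S : AgentSystem N n) (T : Trajectory N n) (D : ℝ) : Prop :=
  ∀ i, (∀ t, 0 ≤ t → DifferentiableWithinAt ℝ (fun s => S.g i (T.x i s)) (Ici 0) t) ∧
    ∀ᶠ t in atTop, ‖derivWithin (fun s => S.g i (T.x i s)) (Ici 0) t‖ ≤ D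

end AgentSystem

/-- On `[0, ∞)` the signal `s` is differentiable, and `s` and its derivative are bounded by `D`. -/
def SignalBound {n : ℕ} (D : ℝ) (s : ℝ → Vec n) : Prop :=
  ∀ t, 0 ≤ t → DifferentiableWithinAt ℝ s (Ici 0) t ∧ ‖s t‖ ≤ D ∧
    ‖derivWithin s (Ici 0) t‖ ≤ D

/-- All attack signals and their time derivatives are bounded by `D`. -/
def Attack.BoundedBy {N n : ℕ} (A : Attack N n) (D : ℝ) : Prop :=
  ∀ i, SignalBound D (A.u i) ∧ SignalBound D (A.lam i) ∧ SignalBound D (A.z i)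

/-- `∂V/∂η₁` at `η = col(η₁, η₂)`. -/
noncomputable def partialFst {n : ℕ} (V : ErrSpace n → ℝ) (η : ErrSpace n) :
    Stack 3 n →L[ℝ] ℝ :=
  fderiv ℝ (fun e : Stack 3 n => V (WithLp.toLp 2 (e, η.snd))) η.fst

/-- `∂V/∂η₂` at `η = col(η₁, η₂)`. -/
noncomputable def partialSnd {n : ℕ} (V : ErrSpace n → ℝ) (η : ErrSpace n) :
    Stack 3 n →L[ℝ] ℝ :=
  fderiv ℝ (fun e : Stack 3 n => V (WithLp.toLp 2 (η.fst, e))) η.snd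

/-- Existence of a quadratic-type Lyapunov function for the scaled observer error.  Positive
definiteness of `V` and `W` is contained in the quadratic bounds. -/
def HasObserverLyapunov {n : ℕ} (h₁ h₂ : Stack 3 n → Stack 3 n) : Prop :=
  ∃ (l₁ l₂ l₃ l₄ l₅ : ℝ) (V W : ErrSpace n → ℝ),
    0 < l₁ ∧ 0 < l₂ ∧ 0 < l₃ ∧ 0 < l₄ ∧ 0 < l₅ ∧
    ContDiff ℝ 1 V ∧ ContDiff ℝ 1 W ∧
    (∀ η, l₁ * ‖η‖ ^ 2 ≤ V η ∧ V η ≤ l₂ * ‖η‖ ^ 2) ∧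
    (∀ η, l₃ * ‖η‖ ^ 2 ≤ W η ∧ W η ≤ l₄ * ‖η‖ ^ 2) ∧
    (∀ η, partialFst V η (η.snd - h₁ η.fst) - partialSnd V η (h₂ η.fst) ≤ -W η) ∧
    (∀ η, ‖partialSnd V η‖ ≤ l₅ * ‖η‖)

/-- The distance `‖X(t) - X*‖` of the allocation to `Xstar`, in `ℝ^{Nn}`. -/
noncomputable def allocationError {N n : ℕ} (T : Trajectory N n) (Xstar : Stack N n) (t : ℝ) : ℝ :=
  ‖col (fun i => T.x i t) - Xstar‖

/-! The closed loop is a cascade: the observer error drives the algorithm but does not depend on it,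
except through the rate of change of the perturbation (attack plus inherent dynamics), which is
eventually bounded in terms of `D` and the weights.

Observer: the known input cancels from the innovation equation. With the estimation error divided by
`w₀`, both error components evolve at speed `w₀` under the flow that `V₁` controls, with a forcing
of size `O(1 / w₀)`. Hence the scaled error is eventually `O(1 / w₀ ^ 2)` and the estimation error
itself `O(1 / w₀)` (`exists_observer_gain`). Nothing is required of `g` beyond the rate of `g i (x i
t)`, and no a priori bound on the state enters.

Algorithm: at the optimum the gradients agree across agents, so `λ* = -∇f` is in consensus, and `x*
- d` has zero sum, so it lies in the range of the Laplacian `L` and equals `L z*`. Around this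
equilibrium the loop is a primal-dual flow forced by the estimation errors. Its energy dissipates
only through `x`, so small cross terms `⟨x, λ⟩` and `⟨λ, z⟩` are added to obtain a strict Lyapunov
function and thereby a linear gain (`exists_saddle_gain`). The component of `z` in `ker L` may
drift, but it never acts on the other variables and is projected away. Multiplying the two gains
gives `C`. -/

/-! ### Scalar comparison, coercivity, and Lyapunov weights. -/

/-- A differential inequality `v' ≤ -α v + β` forces `v` below `2β/α` eventually. -/
theorem eventually_le_of_deriv_le {v v' : ℝ → ℝ} {α β : ℝ} (hα : 0 < α) (hβ : 0 < β)
    (hv : ∀ᶠ t in atTop, HasDerivAt v (v' t) t ∧ v' t ≤ -α * v t + β) :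
    ∀ᶠ t in atTop, v t ≤ 2 * β / α := by
  obtain ⟨T₀, hT₀⟩ := eventually_atTop.1 hv
  -- Integrating factor: `exp (α t) (v - β / α)` is nonincreasing, so `v - β / α` is bounded above
  -- by a decaying exponential.
  have hder : ∀ t, T₀ ≤ t → HasDerivAt (fun s => Real.exp (α * s) * (v s - β / α))
      (Real.exp (α * t) * α * (v t - β / α) + Real.exp (α * t) * v' t) t := by
    intro t ht
    have h1 : HasDerivAt (fun s : ℝ => Real.exp (α * s)) (Real.exp (α * t) * α) t := by
      simpa using ((hasDerivAt_id t).const_mul α).exp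
    exact h1.mul ((hT₀ t ht).1.sub_const _)
  have hanti : AntitoneOn (fun s => Real.exp (α * s) * (v s - β / α)) (Ici T₀) := by
    refine antitoneOn_of_deriv_nonpos (convex_Ici T₀)
      (fun t ht => (hder t ht).continuousAt.continuousWithinAt) ?_ ?_
    · intro t ht
      rw [interior_Ici] at ht
      exact (hder t (le_of_lt ht)).differentiableAt.differentiableWithinAt
    · intro t ht
      rw [interior_Ici] at ht
      rw [(hder t (le_of_lt ht)).deriv]
      have h2 := (hT₀ t (le_of_lt ht)).2
      have h3 : α * (v t - β / α) + v' t ≤ 0 := by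
        have : α * (v t - β / α) = α * v t - β := by field_simp
        linarith
      have h4 := mul_nonpos_of_nonneg_of_nonpos (Real.exp_pos (α * t)).le h3
      linarith
  have hlim : Tendsto (fun t => Real.exp (-(α * t)) *
      (Real.exp (α * T₀) * (v T₀ - β / α))) atTop (𝓝 0) := by
    have h5 : Tendsto (fun t : ℝ => Real.exp (-(α * t))) atTop (𝓝 0) :=
      Real.tendsto_exp_neg_atTop_nhds_zero.comp (tendsto_id.const_mul_atTop hα)
    simpa using h5.mul_const (Real.exp (α * T₀) * (v T₀ - β / α))
  -- The transient eventually falls below a second `β / α`; this is the factor 2 and the reason for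
  -- `0 < β`.
  filter_upwards [hlim.eventually (gt_mem_nhds (div_pos hβ hα)), eventually_ge_atTop T₀]
    with t ht htT
  have h6 : Real.exp (α * t) * (v t - β / α) ≤ Real.exp (α * T₀) * (v T₀ - β / α) :=
    hanti self_mem_Ici htT htT
  have h7 := mul_le_mul_of_nonneg_left h6 (Real.exp_pos (-(α * t))).le
  rw [← mul_assoc, ← Real.exp_add, neg_add_cancel, Real.exp_zero, one_mul] at h7
  have : 2 * β / α = β / α + β / α := by ring
  linarith

/-- A symmetric form which is positive off its kernel is coercive on the orthogonal complement
of the kernel. -/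
theorem exists_coercive_on_orthogonal_ker {E : Type*} [NormedAddCommGroup E]
    [InnerProductSpace ℝ E] [FiniteDimensional ℝ E] (L : E →L[ℝ] E)
    (hpos : ∀ x, 0 ≤ inner ℝ x (L x)) (hker : ∀ x, inner ℝ x (L x) = 0 → L x = 0) :
    ∃ μ : ℝ, 0 < μ ∧ ∀ y ∈ L.kerᗮ, μ * ‖y‖ ^ 2 ≤ inner ℝ y (L y) := by
  have hcomp : IsCompact (Metric.sphere (0 : E) 1 ∩ (L.kerᗮ : Set E)) :=
    (isCompact_sphere 0 1).inter_right (Submodule.isClosed_orthogonal _)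
  have hcont : Continuous fun y : E => inner ℝ y (L y) := by fun_prop
  obtain ⟨μ, hμ, hle⟩ : ∃ μ : ℝ, 0 < μ ∧
      ∀ y ∈ Metric.sphere (0 : E) 1 ∩ (L.kerᗮ : Set E), μ ≤ inner ℝ y (L y) := by
    -- If the set is empty, the orthogonal complement of the kernel is trivial and any constant
    -- serves. Otherwise the minimum over a compact set is attained, and it is positive since a zero
    -- would lie in the kernel and its complement.
    rcases (Metric.sphere (0 : E) 1 ∩ (L.kerᗮ : Set E)).eq_empty_or_nonempty with h | h
    · exact ⟨1, one_pos, by simp [h]⟩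
    · obtain ⟨y, hy, hmin⟩ := hcomp.exists_isMinOn h hcont.continuousOn
      refine ⟨inner ℝ y (L y), lt_of_le_of_ne (hpos y) fun h0 => ?_, fun z hz => hmin hz⟩
      have hyk : y ∈ L.ker := by
        simpa using hker y h0.symm
      have : inner ℝ y y = 0 := Submodule.inner_right_of_mem_orthogonal hyk hy.2
      have hy0 : y = 0 := by simpa using this
      simpa [hy0] using hy.1
  refine ⟨μ, hμ, fun y hy => ?_⟩
  rcases eq_or_ne y 0 with rfl | hy0
  · simp
  · have hn : 0 < ‖y‖ := norm_pos_iff.2 hy0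
    have h1 := hle (‖y‖⁻¹ • y) ⟨by simp [norm_smul, hn.ne'], Submodule.smul_mem _ _ hy⟩
    rw [map_smul, inner_smul_left, inner_smul_right] at h1
    have h2 := mul_le_mul_of_nonneg_right h1 (sq_nonneg ‖y‖)
    have h3 : (starRingEnd ℝ) ‖y‖⁻¹ * (‖y‖⁻¹ * inner ℝ y (L y)) * ‖y‖ ^ 2
        = inner ℝ y (L y) := by
      simp only [conj_trivial]; field_simp
    linarith

/-- Choice of the weights in the composite Lyapunov function of the saddle-point dynamics, with
`X`, `Y`, `Z` the norms of the three components of the state and `ρ` the size of the noise. -/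
theorem exists_lyapunov_weights {m μ k Λ : ℝ} (hm : 0 < m) (hμ : 0 < μ)
    (hΛ : 0 ≤ Λ) :
    ∃ c δ α β : ℝ, 0 < c ∧ c ≤ 1 ∧ 0 < δ ∧ δ ≤ 1 / 4 ∧ 0 < α ∧ 0 < β ∧
      ∀ X Y Z ρ : ℝ, 0 ≤ X → 0 ≤ Y → 0 ≤ Z → 0 ≤ ρ →
        -m * X ^ 2 + ρ * (X + Y + Z)
          + δ * (k * X * Y - Y ^ 2 + ρ * Y + Λ * X * Y + Λ * X * Z + X ^ 2 + X * ρ)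
          + c * δ * (Λ * Y * Z - μ * Z ^ 2 + X * Z + ρ * Z + Λ * Y ^ 2 + Y * ρ)
        ≤ -α * (X ^ 2 + Y ^ 2 + Z ^ 2) + β * ρ ^ 2 := by
  -- `c` makes the terms `Λ Y Z` and `Λ Y ^ 2` of the second cross derivative absorbable by `Y ^ 2`
  -- and `μ Z ^ 2`.
  obtain ⟨c, hc, hc1, hcΛ, hcΛ2⟩ : ∃ c : ℝ, 0 < c ∧ c ≤ 1 ∧ c * Λ ≤ 1 / 4 ∧
      c * Λ ^ 2 ≤ μ / 4 := by
    refine ⟨min 1 (min (1 / (4 * (Λ + 1))) (μ / (4 * (Λ ^ 2 + 1)))), by positivity,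
      min_le_left _ _, ?_, ?_⟩
    · calc _ ≤ 1 / (4 * (Λ + 1)) * Λ :=
            mul_le_mul_of_nonneg_right ((min_le_right _ _).trans (min_le_left _ _)) hΛ
        _ ≤ 1 / 4 := by
          rw [div_mul_eq_mul_div, div_le_div_iff₀ (by positivity) (by positivity)]; linarith
    · calc _ ≤ μ / (4 * (Λ ^ 2 + 1)) * Λ ^ 2 :=
            mul_le_mul_of_nonneg_right ((min_le_right _ _).trans (min_le_right _ _)) (sq_nonneg Λ)
        _ ≤ μ / 4 := by
          rw [div_mul_eq_mul_div, div_le_div_iff₀ (by positivity) (by positivity)]; nlinarith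
  -- `B` collects the coefficients of `δ X ^ 2`: one present from the start, two left by Young's
  -- inequality in `t1` and `t2`. `δ` is then small enough for half of `m X ^ 2` to pay for them.
  set B : ℝ := 1 + 2 * (k + Λ) ^ 2 + (Λ + c) ^ 2 / (c * μ) with hB
  have hBpos : 0 < B := by positivity
  obtain ⟨δ, hδ, hδ1, hδB⟩ : ∃ δ : ℝ, 0 < δ ∧ δ ≤ 1 / 4 ∧ δ * B ≤ m / 2 := by
    refine ⟨min (1 / 4) (m / (2 * B)), by positivity, min_le_left _ _, ?_⟩
    calc _ ≤ m / (2 * B) * B := mul_le_mul_of_nonneg_right (min_le_right _ _) hBpos.le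
      _ = m / 2 := by field_simp
  -- The right-hand sides are the dissipation remaining in `X`, `Y`, `Z`. The factor 2 reserves half
  -- of it for the noise: each use of `young` costs `α` and leaves `ρ ^ 2 / α`, whence `β = 3 / α`.
  obtain ⟨α, hα, hα1, hα2, hα3⟩ : ∃ α : ℝ, 0 < α ∧ 2 * α ≤ m / 2 ∧ 2 * α ≤ 3 / 8 * δ ∧
      2 * α ≤ c * δ * μ / 2 := by
    refine ⟨min (m / 4) (min (3 / 16 * δ) (c * δ * μ / 4)), by positivity, ?_, ?_, ?_⟩
    · linarith [min_le_left (m / 4) (min (3 / 16 * δ) (c * δ * μ / 4))]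
    · linarith [(min_le_right (m / 4) (min (3 / 16 * δ) (c * δ * μ / 4))).trans (min_le_left _ _)]
    · linarith [(min_le_right (m / 4) (min (3 / 16 * δ) (c * δ * μ / 4))).trans (min_le_right _ _)]
  refine ⟨c, δ, α, 3 / α, hc, hc1, hδ, hδ1, hα, by positivity, ?_⟩
  intro X Y Z ρ hX hY hZ hρ
  have t1 : (k + Λ) * X * Y ≤ Y ^ 2 / 8 + 2 * (k + Λ) ^ 2 * X ^ 2 := by
    nlinarith [sq_nonneg (Y - 4 * (k + Λ) * X)]
  have t2 : (Λ + c) * X * Z ≤ c * μ / 4 * Z ^ 2 + (Λ + c) ^ 2 / (c * μ) * X ^ 2 := by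
    have hcμ : 0 < c * μ := by positivity
    have e : c * μ / 4 * Z ^ 2 + (Λ + c) ^ 2 / (c * μ) * X ^ 2 - (Λ + c) * X * Z
        = (c * μ * Z - 2 * (Λ + c) * X) ^ 2 / (4 * (c * μ)) := by
      field_simp; ring
    have : 0 ≤ (c * μ * Z - 2 * (Λ + c) * X) ^ 2 / (4 * (c * μ)) := by positivity
    linarith
  have t3 : c * (Λ * Y * Z) ≤ Y ^ 2 / 4 + c * μ / 4 * Z ^ 2 := by
    have h1 : c * (Λ * Y * Z) ≤ Y ^ 2 / 4 + c * (c * Λ ^ 2) * Z ^ 2 := by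
      nlinarith [sq_nonneg (Y - 2 * c * Λ * Z)]
    have h2 : c * (c * Λ ^ 2) * Z ^ 2 ≤ c * (μ / 4) * Z ^ 2 := by gcongr
    linarith
  have t4 : c * (Λ * Y ^ 2) ≤ Y ^ 2 / 4 := by nlinarith [sq_nonneg Y]
  have t5 : δ * ((k + Λ) * X * Y + (Λ + c) * X * Z + c * (Λ * Y * Z) + c * (Λ * Y ^ 2))
      ≤ δ * (5 / 8 * Y ^ 2 + c * μ / 2 * Z ^ 2 + (B - 1) * X ^ 2) := by
    refine mul_le_mul_of_nonneg_left ?_ hδ.le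
    rw [hB]; linarith
  have t6 : δ * B * X ^ 2 ≤ m / 2 * X ^ 2 := by gcongr
  have hcδ : c * δ ≤ 1 / 4 := by nlinarith
  have t7 : ρ * ((1 + δ) * X + (1 + δ + c * δ) * Y + (1 + c * δ) * Z)
      ≤ ρ * (2 * X + 2 * Y + 2 * Z) := by
    refine mul_le_mul_of_nonneg_left ?_ hρ
    have a1 := mul_le_mul_of_nonneg_right hδ1 hX
    have a2 := mul_le_mul_of_nonneg_right hδ1 hY
    have a3 := mul_le_mul_of_nonneg_right hcδ hY
    have a4 := mul_le_mul_of_nonneg_right hcδ hZ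
    linarith
  have young : ∀ W : ℝ, ρ * (2 * W) ≤ α * W ^ 2 + 1 / α * ρ ^ 2 := by
    intro W
    have e : α * W ^ 2 + 1 / α * ρ ^ 2 - ρ * (2 * W) = (α * W - ρ) ^ 2 / α := by
      field_simp; ring
    have : 0 ≤ (α * W - ρ) ^ 2 / α := by positivity
    linarith
  have b1 := mul_le_mul_of_nonneg_right hα1 (sq_nonneg X)
  have b2 := mul_le_mul_of_nonneg_right hα2 (sq_nonneg Y)
  have b3 := mul_le_mul_of_nonneg_right hα3 (sq_nonneg Z)
  have b4 : 3 / α * ρ ^ 2 = 3 * (1 / α * ρ ^ 2) := by ring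
  linarith [young X, young Y, young Z]

/-! ### Input-to-state stability of the primal-dual flow. -/

section SaddleDynamics

variable {E : Type*} [NormedAddCommGroup E] [InnerProductSpace ℝ E]

/-- Input-to-state stability, with linear gain, of the primal-dual dynamics whose last component
stays in a region where `L` is coercive. -/
theorem exists_saddle_gain_of_coercive (L : E →L[ℝ] E)
    (hsymm : ∀ x y, inner ℝ (L x) y = inner ℝ x (L y)) (hpos : ∀ x, 0 ≤ inner ℝ x (L x))
    {m μ k : ℝ} (hm : 0 < m) (hμ : 0 < μ) :
    ∃ K : ℝ, 0 < K ∧ ∀ (x lam y p e₁ e₂ e₃ : ℝ → E) (ρ : ℝ), 0 < ρ →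
      (∀ᶠ t in atTop, HasDerivAt x (-p t - lam t + e₁ t) t) →
      (∀ᶠ t in atTop, HasDerivAt lam (-L (lam t) - L (y t) + x t + e₂ t) t) →
      (∀ᶠ t in atTop, HasDerivAt y (L (lam t) + e₃ t) t) →
      (∀ᶠ t in atTop, m * ‖x t‖ ^ 2 ≤ inner ℝ (x t) (p t) ∧ ‖p t‖ ≤ k * ‖x t‖) →
      (∀ᶠ t in atTop, μ * ‖y t‖ ^ 2 ≤ inner ℝ (y t) (L (y t))) →
      (∀ᶠ t in atTop, ‖e₁ t‖ ≤ ρ ∧ ‖e₂ t‖ ≤ ρ ∧ ‖e₃ t‖ ≤ ρ) →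
      ∀ᶠ t in atTop, ‖x t‖ ≤ K * ρ := by
  obtain ⟨c, δ, α, β, hc, hc1, hδ, hδ1, hα, hβ, hW⟩ :=
    exists_lyapunov_weights hm hμ (norm_nonneg L)
  -- From `‖x‖ ^ 2 / 4 ≤ U` and, eventually, `U ≤ 2 β ρ ^ 2 / α`.
  refine ⟨Real.sqrt (8 * β / α), by positivity, ?_⟩
  intro x lam y p e₁ e₂ e₃ ρ hρ hx hlam hy hp hyL he
  have hcδ : c * δ ≤ 1 / 4 := by nlinarith
  have hcδ0 : 0 ≤ c * δ := by positivity
  -- The skew couplings cancel in the derivative of the three squares, leaving damping in `x`. The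
  -- derivative of `⟨x, λ⟩` supplies `-‖λ‖ ^ 2`, that of `⟨λ, y⟩` supplies `-⟨y, L y⟩`.
  let U : ℝ → ℝ := fun t => 1 / 2 * inner ℝ (x t) (x t) + 1 / 2 * inner ℝ (lam t) (lam t)
    + 1 / 2 * inner ℝ (y t) (y t) + δ * inner ℝ (x t) (lam t) + c * δ * inner ℝ (lam t) (y t)
  have hUbd : ∀ t, 1 / 4 * (‖x t‖ ^ 2 + ‖lam t‖ ^ 2 + ‖y t‖ ^ 2) ≤ U t ∧
      U t ≤ ‖x t‖ ^ 2 + ‖lam t‖ ^ 2 + ‖y t‖ ^ 2 := by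
    intro t
    have q1 : ‖x t‖ * ‖lam t‖ ≤ (‖x t‖ ^ 2 + ‖lam t‖ ^ 2) / 2 := by
      nlinarith [sq_nonneg (‖x t‖ - ‖lam t‖)]
    have q2 : ‖lam t‖ * ‖y t‖ ≤ (‖lam t‖ ^ 2 + ‖y t‖ ^ 2) / 2 := by
      nlinarith [sq_nonneg (‖lam t‖ - ‖y t‖)]
    have b1 : |δ * inner ℝ (x t) (lam t)| ≤ 1 / 4 * ((‖x t‖ ^ 2 + ‖lam t‖ ^ 2) / 2) := by
      rw [abs_mul, abs_of_pos hδ]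
      exact mul_le_mul hδ1 ((abs_real_inner_le_norm _ _).trans q1) (abs_nonneg _) (by norm_num)
    have b2 : |c * δ * inner ℝ (lam t) (y t)| ≤ 1 / 4 * ((‖lam t‖ ^ 2 + ‖y t‖ ^ 2) / 2) := by
      rw [abs_mul, abs_of_nonneg hcδ0]
      exact mul_le_mul hcδ ((abs_real_inner_le_norm _ _).trans q2) (abs_nonneg _) (by norm_num)
    have b1' := abs_le.1 b1
    have b2' := abs_le.1 b2
    simp only [U, real_inner_self_eq_norm_sq]
    constructor <;> nlinarith [sq_nonneg ‖x t‖, sq_nonneg ‖lam t‖, sq_nonneg ‖y t‖]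
  have key : ∀ᶠ t in atTop, HasDerivAt U (deriv U t) t ∧ deriv U t ≤ -α * U t + β * ρ ^ 2 := by
    filter_upwards [hx, hlam, hy, hp, hyL, he] with t hx hlam hy hp hyL he
    have hU := (((((hx.inner ℝ hx).const_mul (1 / 2)).add ((hlam.inner ℝ hlam).const_mul (1 / 2))).add
      ((hy.inner ℝ hy).const_mul (1 / 2))).add ((hx.inner ℝ hlam).const_mul δ)).add
      ((hlam.inner ℝ hy).const_mul (c * δ))
    have hU' : HasDerivAt U _ t := hU
    refine ⟨hU'.differentiableAt.hasDerivAt, ?_⟩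
    rw [hU'.deriv]
    have hw := hW ‖x t‖ ‖lam t‖ ‖y t‖ ρ (norm_nonneg _) (norm_nonneg _) (norm_nonneg _) hρ.le
    have hub := (mul_le_mul_of_nonneg_left (hUbd t).2 hα.le)
    have ie : ∀ u v : E, inner ℝ u v ≤ ‖u‖ * ‖v‖ := real_inner_le_norm
    have ie' : ∀ u v : E, -inner ℝ u v ≤ ‖u‖ * ‖v‖ := fun u v =>
      (neg_le_abs _).trans (abs_real_inner_le_norm u v)
    have bd : ∀ {u v : E} {b : ℝ}, ‖v‖ ≤ b → inner ℝ u v ≤ ‖u‖ * b := fun {u v b} h =>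
      (ie u v).trans (mul_le_mul_of_nonneg_left h (norm_nonneg _))
    have bd' : ∀ {u v : E} {b : ℝ}, ‖v‖ ≤ b → -inner ℝ u v ≤ ‖u‖ * b := fun {u v b} h =>
      (ie' u v).trans (mul_le_mul_of_nonneg_left h (norm_nonneg _))
    have n1 := bd (u := x t) he.1
    have n2 := bd (u := lam t) he.2.1
    have n3 := bd (u := y t) he.2.2
    have n4 := bd' (u := lam t) hp.2
    have n5 := bd (u := lam t) he.1
    have n6 := bd' (u := x t) (L.le_opNorm (lam t))
    have n7 := bd' (u := x t) (L.le_opNorm (y t))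
    have n8 := bd (u := x t) he.2.1
    have n9 := bd' (u := y t) (L.le_opNorm (lam t))
    have n10 := ie (x t) (y t)
    have n11 := bd (u := y t) he.2.1
    have n12 := bd (u := lam t) (L.le_opNorm (lam t))
    have n13 := bd (u := lam t) he.2.2
    have n14 := hpos (lam t)
    have s1 : inner ℝ (lam t) (L (y t)) = inner ℝ (y t) (L (lam t)) := by
      rw [← hsymm, real_inner_comm]
    have d1 : inner ℝ (-p t - lam t + e₁ t) (lam t) + inner ℝ (x t)
        (-L (lam t) - L (y t) + x t + e₂ t) ≤
        k * ‖x t‖ * ‖lam t‖ - ‖lam t‖ ^ 2 + ρ * ‖lam t‖ + ‖L‖ * ‖x t‖ * ‖lam t‖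
          + ‖L‖ * ‖x t‖ * ‖y t‖ + ‖x t‖ ^ 2 + ‖x t‖ * ρ := by
      simp only [inner_add_left, inner_add_right, inner_sub_left, inner_sub_right, inner_neg_left,
        inner_neg_right, real_inner_self_eq_norm_sq]
      rw [real_inner_comm (lam t) (p t), real_inner_comm (lam t) (e₁ t)]
      linarith
    have d2 : inner ℝ (-L (lam t) - L (y t) + x t + e₂ t) (y t) + inner ℝ (lam t)
        (L (lam t) + e₃ t) ≤
        ‖L‖ * ‖lam t‖ * ‖y t‖ - μ * ‖y t‖ ^ 2 + ‖x t‖ * ‖y t‖ + ρ * ‖y t‖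
          + ‖L‖ * ‖lam t‖ ^ 2 + ‖lam t‖ * ρ := by
      simp only [inner_add_left, inner_add_right, inner_sub_left, inner_neg_left]
      rw [real_inner_comm (y t) (L (lam t)), real_inner_comm (y t) (L (y t)),
        real_inner_comm (y t) (e₂ t)]
      linarith
    have d3 : 1 / 2 * (inner ℝ (x t) (-p t - lam t + e₁ t) + inner ℝ (-p t - lam t + e₁ t) (x t))
        + 1 / 2 * (inner ℝ (lam t) (-L (lam t) - L (y t) + x t + e₂ t)
          + inner ℝ (-L (lam t) - L (y t) + x t + e₂ t) (lam t))
        + 1 / 2 * (inner ℝ (y t) (L (lam t) + e₃ t) + inner ℝ (L (lam t) + e₃ t) (y t))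
        ≤ -m * ‖x t‖ ^ 2 + ρ * (‖x t‖ + ‖lam t‖ + ‖y t‖) := by
      rw [real_inner_comm (x t) (-p t - lam t + e₁ t), real_inner_comm (lam t)
        (-L (lam t) - L (y t) + x t + e₂ t), real_inner_comm (y t) (L (lam t) + e₃ t)]
      simp only [inner_add_right, inner_sub_right, inner_neg_right]
      rw [real_inner_comm (x t) (lam t)]
      linarith
    have d1' := mul_le_mul_of_nonneg_left d1 hδ.le
    have d2' := mul_le_mul_of_nonneg_left d2 hcδ0
    linarith
  filter_upwards [eventually_le_of_deriv_le hα (by positivity) key] with t ht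
  have h1 : ‖x t‖ ^ 2 ≤ 8 * β / α * ρ ^ 2 := by
    have e : 2 * (β * ρ ^ 2) / α * 4 = 8 * β / α * ρ ^ 2 := by ring
    nlinarith [(hUbd t).1, sq_nonneg ‖lam t‖, sq_nonneg ‖y t‖]
  refine abs_le_of_sq_le_sq' ?_ (by positivity) |>.2
  rwa [mul_pow, Real.sq_sqrt (by positivity)]

/-- Input-to-state stability of the primal-dual dynamics, modulo drift of the last component
along the kernel of `L`. -/
theorem exists_saddle_gain [FiniteDimensional ℝ E] (L : E →L[ℝ] E)
    (hsymm : ∀ x y, inner ℝ (L x) y = inner ℝ x (L y)) (hpos : ∀ x, 0 ≤ inner ℝ x (L x))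
    (hker : ∀ x, inner ℝ x (L x) = 0 → L x = 0)
    {m k : ℝ} (hm : 0 < m) :
    ∃ K : ℝ, 0 < K ∧ ∀ (x lam z p e₁ e₂ e₃ : ℝ → E) (ρ : ℝ), 0 < ρ →
      (∀ᶠ t in atTop, HasDerivAt x (-p t - lam t + e₁ t) t) →
      (∀ᶠ t in atTop, HasDerivAt lam (-L (lam t) - L (z t) + x t + e₂ t) t) →
      (∀ᶠ t in atTop, HasDerivAt z (L (lam t) + e₃ t) t) →
      (∀ᶠ t in atTop, m * ‖x t‖ ^ 2 ≤ inner ℝ (x t) (p t) ∧ ‖p t‖ ≤ k * ‖x t‖) →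
      (∀ᶠ t in atTop, ‖e₁ t‖ ≤ ρ ∧ ‖e₂ t‖ ≤ ρ ∧ ‖e₃ t‖ ≤ ρ) →
      ∀ᶠ t in atTop, ‖x t‖ ≤ K * ρ := by
  obtain ⟨μ, hμ, hcoer⟩ := exists_coercive_on_orthogonal_ker L hpos hker
  obtain ⟨K, hK, h⟩ := exists_saddle_gain_of_coercive L hsymm hpos hm hμ
  refine ⟨K, hK, ?_⟩
  intro x lam z p e₁ e₂ e₃ ρ hρ hx hlam hz hp he
  -- Since `P L = L = L P` and `‖P‖ ≤ 1`, replacing `z` by `P z` and `e₃` by `P e₃` preserves the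
  -- equations and the noise bound, and `L` is coercive on the range of `P`.
  let P : E →L[ℝ] E := L.kerᗮ.starProjection
  have hPL : ∀ v, P (L v) = L v := fun v => by
    refine Submodule.starProjection_eq_self_iff.2 fun u hu => ?_
    have hu0 : L u = 0 := by simpa using hu
    rw [← hsymm, hu0, inner_zero_left]
  have hLP : ∀ v, L (P v) = L v := fun v => by
    have h1 := Submodule.sub_starProjection_mem_orthogonal (K := L.kerᗮ) v
    rw [Submodule.orthogonal_orthogonal] at h1
    have h2 : L (v - P v) = 0 := LinearMap.mem_ker.1 h1
    rw [map_sub, sub_eq_zero] at h2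
    exact h2.symm
  have hPn : ∀ v, ‖P v‖ ≤ ‖v‖ := fun v => by
    simpa using P.le_of_opNorm_le (Submodule.starProjection_norm_le L.kerᗮ) v
  refine h x lam (fun t => P (z t)) p e₁ e₂ (fun t => P (e₃ t)) ρ hρ hx ?_ ?_ hp ?_ ?_
  · simpa only [hLP] using hlam
  · filter_upwards [hz] with t ht
    have := P.hasFDerivAt.comp_hasDerivAt t ht
    rwa [map_add, hPL] at this
  · exact Eventually.of_forall fun t => hcoer _ (Submodule.starProjection_apply_mem _ _)
  · filter_upwards [he] with t ht
    exact ⟨ht.1, ht.2.1, (hPn _).trans ht.2.2⟩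

end SaddleDynamics

/-! ### Error of the extended state observer. -/

/-- The chain rule along a curve in an `L²` product, in terms of partial derivatives. -/
theorem hasDerivAt_comp_toLp_prodMk {E F : Type*} [NormedAddCommGroup E] [NormedSpace ℝ E]
    [NormedAddCommGroup F] [NormedSpace ℝ F] {V : WithLp 2 (E × F) → ℝ} (hV : Differentiable ℝ V)
    {f : ℝ → E} {g : ℝ → F} {f' : E} {g' : F} {t : ℝ}
    (hf : HasDerivAt f f' t) (hg : HasDerivAt g g' t) :
    HasDerivAt (fun s => V (WithLp.toLp 2 (f s, g s)))
      (fderiv ℝ (fun e : E => V (WithLp.toLp 2 (e, g t))) (f t) f'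
        + fderiv ℝ (fun e : F => V (WithLp.toLp 2 (f t, e))) (g t) g') t := by
  let J : (E × F) →L[ℝ] WithLp 2 (E × F) :=
    (WithLp.prodContinuousLinearEquiv 2 ℝ E F).symm.toContinuousLinearMap
  have hVJ : HasFDerivAt (fun p : E × F => V (WithLp.toLp 2 p))
      ((fderiv ℝ V (J (f t, g t))).comp J) (f t, g t) :=
    (hV (J (f t, g t))).hasFDerivAt.comp (f t, g t) J.hasFDerivAt
  have h1 := (hVJ.comp (f := fun e => (e, g t)) (f t) (hasFDerivAt_prodMk_left (f t) (g t))).fderiv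
  have h2 := (hVJ.comp (f := fun e => (f t, e)) (g t) (hasFDerivAt_prodMk_right (f t) (g t))).fderiv
  have h3 := hVJ.comp_hasDerivAt t (hf.prodMk hg)
  simp only [Function.comp_def] at h1 h2 h3
  have h4 : (f', g') = ContinuousLinearMap.inl ℝ E F f' + ContinuousLinearMap.inr ℝ E F g' := by
    simp
  rw [h4, map_add] at h3
  rw [h1, h2]
  exact h3

/-- The error of the extended state observer: if the perturbation drifts at rate at most `M`, its
estimation error is eventually at most a multiple of `1 / w₀`. -/
theorem exists_observer_gain {n : ℕ} {h₁ h₂ : Stack 3 n → Stack 3 n}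
    (hh : HasObserverLyapunov h₁ h₂) {M : ℝ} (hM : 0 < M) :
    ∃ K : ℝ, 0 < K ∧ ∀ w : ℝ, 0 < w → ∀ e₁ e₂ r : ℝ → Stack 3 n,
      (∀ᶠ t in atTop, HasDerivAt e₁ (e₂ t - w • h₁ (e₁ t)) t) →
      (∀ᶠ t in atTop, HasDerivAt e₂ (r t - w ^ 2 • h₂ (e₁ t)) t) →
      (∀ᶠ t in atTop, ‖r t‖ ≤ M) →
      ∀ᶠ t in atTop, ‖e₂ t‖ ≤ K / w := by
  obtain ⟨l₁, l₂, l₃, l₄, l₅, V, W, hl₁, hl₂, hl₃, hl₄, hl₅, hV, -, hVb, hWb, hdec, hpar⟩ := hh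
  refine ⟨Real.sqrt (2 * l₂ * l₅ ^ 2 * M ^ 2 / (l₁ * l₃ ^ 2)), by positivity, ?_⟩
  intro w hw e₁ e₂ r he₁ he₂ hr
  -- This scaling turns the gains `w` and `w ^ 2` into a common factor: `η' = w (η₂ - h₁ η₁, -h₂ η₁)
  -- + (0, r / w)`.
  let η : ℝ → ErrSpace n := fun t => WithLp.toLp 2 (e₁ t, w⁻¹ • e₂ t)
  -- Half of the decay `w l₃ ‖η‖ ^ 2` absorbs the forcing `l₅ ‖η‖ M / w` by completing the square;
  -- the other half gives the rate, through `V ≤ l₂ ‖η‖ ^ 2`.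
  have hα : 0 < w * l₃ / (2 * l₂) := by positivity
  have hβ : 0 < l₅ ^ 2 * M ^ 2 / (2 * l₃ * w ^ 3) := by positivity
  have key : ∀ᶠ t in atTop, HasDerivAt (fun t => V (η t)) (deriv (fun t => V (η t)) t) t ∧
      deriv (fun t => V (η t)) t
        ≤ -(w * l₃ / (2 * l₂)) * V (η t) + l₅ ^ 2 * M ^ 2 / (2 * l₃ * w ^ 3) := by
    filter_upwards [he₁, he₂, hr] with t he₁ he₂ hr
    have hs : HasDerivAt (fun s => w⁻¹ • e₂ s) (w⁻¹ • (r t - w ^ 2 • h₂ (e₁ t))) t :=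
      he₂.fun_const_smul w⁻¹
    have hd : HasDerivAt (fun t => V (η t)) (partialFst V (η t) (e₂ t - w • h₁ (e₁ t))
        + partialSnd V (η t) (w⁻¹ • (r t - w ^ 2 • h₂ (e₁ t)))) t :=
      hasDerivAt_comp_toLp_prodMk (hV.differentiable one_ne_zero) he₁ hs
    refine ⟨hd.differentiableAt.hasDerivAt, ?_⟩
    rw [hd.deriv]
    have c1 : e₂ t - w • h₁ (e₁ t) = w • ((η t).snd - h₁ (η t).fst) := by
      simp [η, smul_sub, smul_smul, hw.ne']
    have c2 : w⁻¹ • (r t - w ^ 2 • h₂ (e₁ t)) = w⁻¹ • r t - w • h₂ (η t).fst := by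
      have : w⁻¹ * w ^ 2 = w := by field_simp
      simp [η, smul_sub, smul_smul, this]
    rw [c1, c2, ContinuousLinearMap.map_smul, (partialSnd V (η t)).map_sub,
      ContinuousLinearMap.map_smul, ContinuousLinearMap.map_smul, smul_eq_mul, smul_eq_mul,
      smul_eq_mul]
    have q1 : w * (partialFst V (η t) ((η t).snd - h₁ (η t).fst)
        - partialSnd V (η t) (h₂ (η t).fst)) ≤ w * -(l₃ * ‖η t‖ ^ 2) :=
      mul_le_mul_of_nonneg_left ((hdec (η t)).trans (neg_le_neg (hWb (η t)).1)) hw.le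
    have q2 : partialSnd V (η t) (r t) ≤ l₅ * ‖η t‖ * M :=
      (le_abs_self _).trans <| (ContinuousLinearMap.le_opNorm _ _).trans <|
        mul_le_mul (hpar (η t)) hr (norm_nonneg _) (by positivity)
    have q3 := mul_le_mul_of_nonneg_left q2 (inv_pos.2 hw).le
    have q4 : w⁻¹ * (l₅ * ‖η t‖ * M)
        ≤ w * l₃ / 2 * ‖η t‖ ^ 2 + l₅ ^ 2 * M ^ 2 / (2 * l₃ * w ^ 3) := by
      have e : w * l₃ / 2 * ‖η t‖ ^ 2 + l₅ ^ 2 * M ^ 2 / (2 * l₃ * w ^ 3)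
          - w⁻¹ * (l₅ * ‖η t‖ * M) = (w ^ 2 * l₃ * ‖η t‖ - l₅ * M) ^ 2 / (2 * l₃ * w ^ 3) := by
        field_simp; ring
      have : 0 ≤ (w ^ 2 * l₃ * ‖η t‖ - l₅ * M) ^ 2 / (2 * l₃ * w ^ 3) := by positivity
      linarith
    have q5 : w * l₃ / (2 * l₂) * V (η t) ≤ w * l₃ / 2 * ‖η t‖ ^ 2 := by
      calc _ ≤ w * l₃ / (2 * l₂) * (l₂ * ‖η t‖ ^ 2) :=
            mul_le_mul_of_nonneg_left (hVb (η t)).2 hα.le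
        _ = _ := by field_simp
    linarith
  filter_upwards [eventually_le_of_deriv_le hα hβ key] with t ht
  have h1 : l₁ * ‖w⁻¹ • e₂ t‖ ^ 2 ≤ 2 * (l₅ ^ 2 * M ^ 2 / (2 * l₃ * w ^ 3)) / (w * l₃ / (2 * l₂)) := by
    refine le_trans ?_ ((hVb (η t)).1.trans ht)
    have : ‖η t‖ ^ 2 = ‖e₁ t‖ ^ 2 + ‖w⁻¹ • e₂ t‖ ^ 2 := WithLp.prod_norm_sq_eq_of_L2 _
    rw [this]
    nlinarith [sq_nonneg ‖e₁ t‖]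
  have h2 : ‖e₂ t‖ ^ 2 ≤ 2 * l₂ * l₅ ^ 2 * M ^ 2 / (l₁ * l₃ ^ 2) / w ^ 2 := by
    rw [norm_smul, norm_inv, Real.norm_of_nonneg hw.le] at h1
    have e1 : l₁ * (w⁻¹ * ‖e₂ t‖) ^ 2 = ‖e₂ t‖ ^ 2 * (l₁ / w ^ 2) := by field_simp
    rw [e1, ← le_div_iff₀ (by positivity)] at h1
    refine h1.trans (le_of_eq ?_)
    field_simp
  refine (abs_le_of_sq_le_sq' ?_ (by positivity)).2
  rwa [div_pow, Real.sq_sqrt (by positivity)]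

/-! ### Stacked vectors. -/

section PiL2

variable {ι F : Type*} [Fintype ι] [NormedAddCommGroup F]

theorem HasDerivAt.toLp_pi [NormedSpace ℝ F] {f : ι → ℝ → F} {f' : ι → F} {t : ℝ}
    (h : ∀ i, HasDerivAt (f i) (f' i) t) :
    HasDerivAt (fun s => (WithLp.toLp 2 (fun i => f i s) : PiLp 2 (fun _ : ι => F)))
      (WithLp.toLp 2 f') t :=
  (PiLp.hasFDerivAt_toLp 2 (fun i => f i t)).comp_hasDerivAt t (hasDerivAt_pi.2 h)

theorem PiLp.norm_le_sum_norm (v : PiLp 2 (fun _ : ι => F)) : ‖v‖ ≤ ∑ i, ‖v i‖ := by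
  have h : ‖v‖ ^ 2 ≤ (∑ i, ‖v i‖) ^ 2 := by
    rw [PiLp.norm_sq_eq_of_L2]
    exact Finset.sum_sq_le_sq_sum_of_nonneg fun i _ => norm_nonneg _
  exact (abs_le_of_sq_le_sq' h (Finset.sum_nonneg fun i _ => norm_nonneg _)).2

theorem PiLp.norm_le_mul_norm {v w : PiLp 2 (fun _ : ι => F)} {k : ℝ} (hk : 0 ≤ k)
    (h : ∀ i, ‖v i‖ ≤ k * ‖w i‖) : ‖v‖ ≤ k * ‖w‖ := by
  have h : ‖v‖ ^ 2 ≤ (k * ‖w‖) ^ 2 := by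
    rw [mul_pow, PiLp.norm_sq_eq_of_L2, PiLp.norm_sq_eq_of_L2, Finset.mul_sum]
    refine Finset.sum_le_sum fun i _ => ?_
    rw [← mul_pow]
    exact pow_le_pow_left₀ (norm_nonneg _) (h i) 2
  exact (abs_le_of_sq_le_sq' h (by positivity)).2

end PiL2

section Stack

variable {k n : ℕ}

/-- Links the flat model of `ℝ^{kn}`, indexed by pairs, to the iterated `PiLp` on which the
Laplacian acts. -/
theorem norm_col (v : Fin k → Vec n) :
    ‖col v‖ = ‖(WithLp.toLp 2 v : PiLp 2 (fun _ : Fin k => Vec n))‖ := by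
  rw [← sq_eq_sq₀ (norm_nonneg _) (norm_nonneg _), PiLp.norm_sq_eq_of_L2,
    PiLp.norm_sq_eq_of_L2, Fintype.sum_prod_type]
  refine Finset.sum_congr rfl fun i _ => ?_
  rw [PiLp.norm_sq_eq_of_L2]
  rfl

theorem col_block (X : Stack k n) : col (block X) = X := rfl

theorem norm_block_le (X : Stack k n) (i : Fin k) : ‖block X i‖ ≤ ‖X‖ := by
  conv_rhs => rw [← col_block X, norm_col]
  exact PiLp.norm_apply_le (WithLp.toLp 2 (block X) : PiLp 2 (fun _ : Fin k => Vec n)) i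

theorem HasDerivAt.col {v : ℝ → Fin k → Vec n} {v' : Fin k → Vec n} {t : ℝ}
    (h : ∀ i, HasDerivAt (fun s => v s i) (v' i) t) :
    HasDerivAt (fun s => col (v s)) (col v') t := by
  let J : (Fin k → Vec n) →L[ℝ] Stack k n := LinearMap.toContinuousLinearMap
    { toFun := _root_.col, map_add' := fun _ _ => rfl, map_smul' := fun _ _ => rfl }
  exact J.hasFDerivAt.comp_hasDerivAt t (hasDerivAt_pi.2 h)

theorem norm_col_three_le (a b c : Vec n) : ‖col ![a, b, c]‖ ≤ ‖a‖ + ‖b‖ + ‖c‖ := by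
  rw [norm_col]
  refine (PiLp.norm_le_sum_norm _).trans (le_of_eq ?_)
  simp [Fin.sum_univ_three]

end Stack

/-! ### The weighted graph Laplacian. -/

section Laplacian

variable {N : ℕ} {F : Type*} [NormedAddCommGroup F] [InnerProductSpace ℝ F]
  [FiniteDimensional ℝ F]

/-- The weighted graph Laplacian acting on `F`-valued states of the agents. -/
noncomputable def laplacian (a : Matrix (Fin N) (Fin N) ℝ) :
    PiLp 2 (fun _ : Fin N => F) →L[ℝ] PiLp 2 (fun _ : Fin N => F) :=
  LinearMap.toContinuousLinearMap
    { toFun := fun v => WithLp.toLp 2 fun i => ∑ j, a i j • (v i - v j)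
      map_add' := fun v w => by
        ext i
        simp only [PiLp.add_apply, ← Finset.sum_add_distrib, ← smul_add]
        exact Finset.sum_congr rfl fun j _ => by congr 1; abel
      map_smul' := fun c v => by
        ext i
        simp only [PiLp.smul_apply, Finset.smul_sum, RingHom.id_apply]
        exact Finset.sum_congr rfl fun j _ => by rw [← smul_sub, smul_comm] }

theorem laplacian_apply (a : Matrix (Fin N) (Fin N) ℝ) (v : PiLp 2 (fun _ : Fin N => F))
    (i : Fin N) : laplacian a v i = ∑ j, a i j • (v i - v j) := rfl

/-- Average the double sum with its copy in which `i` and `j` are exchanged. Symmetry and positivity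
of the Laplacian both follow from this form. -/
theorem inner_laplacian {a : Matrix (Fin N) (Fin N) ℝ} (ha : a.IsSymm)
    (v w : PiLp 2 (fun _ : Fin N => F)) :
    inner ℝ v (laplacian a w)
      = 1 / 2 * ∑ i, ∑ j, a i j * inner ℝ (v i - v j) (w i - w j) := by
  have h1 : inner ℝ v (laplacian a w) = ∑ i, ∑ j, a i j * inner ℝ (v i) (w i - w j) := by
    simp only [PiLp.inner_apply, laplacian_apply, inner_sum, inner_smul_right]
  have h2 : inner ℝ v (laplacian a w) = ∑ i, ∑ j, a i j * inner ℝ (v j) (w j - w i) := by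
    rw [h1, Finset.sum_comm]
    exact Finset.sum_congr rfl fun i _ => Finset.sum_congr rfl fun j _ => by rw [ha.apply]
  have h3 : ∑ i, ∑ j, a i j * inner ℝ (v i - v j) (w i - w j)
      = inner ℝ v (laplacian a w) + inner ℝ v (laplacian a w) := by
    conv_rhs => rw [h1]
    conv_rhs => enter [2]; rw [← h1, h2]
    simp only [← Finset.sum_add_distrib]
    refine Finset.sum_congr rfl fun i _ => Finset.sum_congr rfl fun j _ => ?_
    rw [inner_sub_left, ← neg_sub (w i) (w j), inner_neg_right]
    ring
  rw [h3]; ring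

theorem inner_laplacian_left {a : Matrix (Fin N) (Fin N) ℝ} (ha : a.IsSymm)
    (v w : PiLp 2 (fun _ : Fin N => F)) :
    inner ℝ (laplacian a v) w = inner ℝ v (laplacian a w) := by
  rw [real_inner_comm, inner_laplacian ha, inner_laplacian ha]
  simp only [real_inner_comm]

theorem IsWeighting.nonneg {G : SimpleGraph (Fin N)} {a : Matrix (Fin N) (Fin N) ℝ}
    (ha : IsWeighting G a) (i j : Fin N) : 0 ≤ a i j := by
  by_cases h : G.Adj i j
  · exact (ha.2.1 i j h).le
  · exact (ha.2.2 i j h).ge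

theorem inner_laplacian_self_nonneg {G : SimpleGraph (Fin N)} {a : Matrix (Fin N) (Fin N) ℝ}
    (ha : IsWeighting G a) (v : PiLp 2 (fun _ : Fin N => F)) :
    0 ≤ inner ℝ v (laplacian a v) := by
  rw [inner_laplacian ha.1]
  refine mul_nonneg (by norm_num) (Finset.sum_nonneg fun i _ => Finset.sum_nonneg fun j _ => ?_)
  exact mul_nonneg (ha.nonneg i j) real_inner_self_nonneg

/-- A vanishing sum of nonnegative terms forces agreement along each edge, hence along walks. -/
theorem eq_of_inner_laplacian_self_eq_zero {G : SimpleGraph (Fin N)} (hG : G.Connected)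
    {a : Matrix (Fin N) (Fin N) ℝ} (ha : IsWeighting G a) {v : PiLp 2 (fun _ : Fin N => F)}
    (hv : inner ℝ v (laplacian a v) = 0) (i j : Fin N) : v i = v j := by
  have hterm : ∀ i j, 0 ≤ a i j * inner ℝ (v i - v j) (v i - v j) := fun i j =>
    mul_nonneg (ha.nonneg i j) real_inner_self_nonneg
  have hadj : ∀ i j, G.Adj i j → v i = v j := by
    intro i j hij
    rw [inner_laplacian ha.1] at hv
    have h0 : ∑ i, ∑ j, a i j * inner ℝ (v i - v j) (v i - v j) = 0 := by linarith
    rw [Finset.sum_eq_zero_iff_of_nonneg fun i _ => Finset.sum_nonneg fun j _ => hterm i j] at h0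
    have h1 := h0 i (Finset.mem_univ i)
    rw [Finset.sum_eq_zero_iff_of_nonneg fun j _ => hterm i j] at h1
    rcases mul_eq_zero.1 (h1 j (Finset.mem_univ j)) with h | h
    · exact absurd h (ha.2.1 i j hij).ne'
    · exact sub_eq_zero.1 (inner_self_eq_zero.1 h)
  obtain ⟨p⟩ := hG.preconnected i j
  induction p with
  | nil => rfl
  | cons h _ ih => exact (hadj _ _ h).trans ih

theorem laplacian_eq_zero_of_inner_self {G : SimpleGraph (Fin N)} (hG : G.Connected)
    {a : Matrix (Fin N) (Fin N) ℝ} (ha : IsWeighting G a) {v : PiLp 2 (fun _ : Fin N => F)}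
    (hv : inner ℝ v (laplacian a v) = 0) : laplacian a v = 0 := by
  ext i
  rw [laplacian_apply]
  exact Finset.sum_eq_zero fun j _ => by
    rw [eq_of_inner_laplacian_self_eq_zero hG ha hv i j, sub_self, smul_zero]

/-- On a connected graph, every state with zero sum is in the range of the Laplacian. -/
theorem exists_laplacian_eq {G : SimpleGraph (Fin N)} (hG : G.Connected)
    {a : Matrix (Fin N) (Fin N) ℝ} (ha : IsWeighting G a) (w : PiLp 2 (fun _ : Fin N => F))
    (hw : ∑ i, w i = 0) : ∃ z, laplacian a z = w := by
  let T : PiLp 2 (fun _ : Fin N => F) →ₗ[ℝ] PiLp 2 (fun _ : Fin N => F) := (laplacian a).toLinearMap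
  have hT : T.IsSymmetric := fun x y => inner_laplacian_left ha.1 x y
  -- The kernel consists of consensus states, to which zero-sum states are orthogonal; the range of
  -- a symmetric operator is the orthogonal complement of its kernel.
  have hmem : w ∈ T.ker.orthogonal := by
    intro v hv
    have hv0 : laplacian a v = 0 := LinearMap.mem_ker.1 hv
    have hcons := eq_of_inner_laplacian_self_eq_zero hG ha (v := v) (by rw [hv0, inner_zero_right])
    obtain ⟨i₀⟩ := hG.nonempty
    rw [PiLp.inner_apply]
    simp only [hcons _ i₀]
    rw [← inner_sum, hw, inner_zero_right]
  rw [← hT.orthogonal_range, Submodule.orthogonal_orthogonal] at hmem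
  exact hmem

theorem sum_laplacian {a : Matrix (Fin N) (Fin N) ℝ} (ha : a.IsSymm)
    (v : PiLp 2 (fun _ : Fin N => F)) : ∑ i, laplacian a v i = 0 := by
  have h : ∑ i, laplacian a v i = -∑ i, laplacian a v i := by
    simp only [laplacian_apply]
    conv_lhs => rw [Finset.sum_comm]
    simp only [← Finset.sum_neg_distrib]
    refine Finset.sum_congr rfl fun i _ => Finset.sum_congr rfl fun j _ => ?_
    rw [ha.apply, ← smul_neg, neg_sub]
  have h2 : (2 : ℝ) • ∑ i, laplacian a v i = 0 := by
    rw [two_smul]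
    exact add_eq_zero_iff_eq_neg.2 h
  exact (smul_eq_zero.1 h2).resolve_left two_ne_zero

end Laplacian

/-! ### Strong monotonicity and first-order optimality. -/

section Optimality

variable {F : Type*} [NormedAddCommGroup F] [InnerProductSpace ℝ F] [CompleteSpace F]

theorem hasDerivAt_comp_add_smul {f : F → ℝ} (hf : Differentiable ℝ f) (y v : F) (s : ℝ) :
    HasDerivAt (fun s : ℝ => f (y + s • v)) (inner ℝ (gradient f (y + s • v)) v) s := by
  have h1 : HasDerivAt (fun s : ℝ => y + s • v) v s := by
    simpa using ((hasDerivAt_id s).smul_const v).const_add y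
  have h2 := (hf (y + s • v)).hasGradientAt.hasFDerivAt.comp_hasDerivAt s h1
  simpa [Function.comp_def] using h2

/-- The gradient of a strongly convex function is strongly monotone. -/
theorem StrongConvexOn.mul_sq_norm_sub_le_inner_gradient {f : F → ℝ} {m : ℝ}
    (hc : StrongConvexOn univ m f) (hf : Differentiable ℝ f) (x y : F) :
    m * ‖x - y‖ ^ 2 ≤ inner ℝ (x - y) (gradient f x - gradient f y) := by
  have hconv : ConvexOn ℝ univ
      (fun s : ℝ => f (y + s • (x - y)) - m / 2 * ‖y + s • (x - y)‖ ^ 2) := by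
    have h := (strongConvexOn_iff_convex.1 hc).comp_affineMap (AffineMap.lineMap y x)
    simpa [Function.comp_def, AffineMap.lineMap_apply_module', add_comm] using h
  have hder : ∀ s : ℝ, HasDerivAt
      (fun s : ℝ => f (y + s • (x - y)) - m / 2 * ‖y + s • (x - y)‖ ^ 2)
      (inner ℝ (gradient f (y + s • (x - y))) (x - y)
        - m / 2 * (2 * inner ℝ (y + s • (x - y)) (x - y))) s := by
    intro s
    have h1 : HasDerivAt (fun s : ℝ => y + s • (x - y)) (x - y) s := by
      simpa using ((hasDerivAt_id s).smul_const (x - y)).const_add y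
    exact (hasDerivAt_comp_add_smul hf y (x - y) s).sub (h1.norm_sq.const_mul (m / 2))
  -- On the segment from `y` to `x`, the chord slope of the convex function lies between its end
  -- derivatives; comparing these is the claim.
  have h0 := hconv.le_slope_of_hasDerivAt (mem_univ 0) (mem_univ 1) one_pos (hder 0)
  have h1 := hconv.slope_le_of_hasDerivAt (mem_univ 0) (mem_univ 1) one_pos (hder 1)
  have h := h0.trans h1
  simp only [zero_smul, one_smul, add_zero, add_sub_cancel] at h
  have e : ‖x - y‖ ^ 2 = inner ℝ x (x - y) - inner ℝ y (x - y) := by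
    rw [← inner_sub_left, real_inner_self_eq_norm_sq]
  have e' : inner ℝ (x - y) (gradient f x - gradient f y)
      = inner ℝ (gradient f x) (x - y) - inner ℝ (gradient f y) (x - y) := by
    rw [← inner_sub_left, real_inner_comm]
  rw [e, e']
  linarith

end Optimality

/-- First-order optimality: the stacked gradient at the optimum annihilates zero-sum directions. -/
theorem AgentSystem.IsOptimal.sum_inner_gradient_eq_zero {N n : ℕ} {S : AgentSystem N n}
    {X : Stack N n} (hX : S.IsOptimal X) (hf : ∀ i, Differentiable ℝ (S.f i))
    {w : Fin N → Vec n} (hw : ∑ i, w i = 0) :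
    ∑ i, inner ℝ (gradient (S.f i) (block X i)) (w i) = 0 := by
  have hblock : ∀ (s : ℝ) i, block (X + s • col w) i = block X i + s • w i := fun _ _ => rfl
  have hmin : IsLocalMin (fun s : ℝ => ∑ i, S.f i (block X i + s • w i)) 0 := by
    refine Eventually.of_forall fun s => ?_
    have hfeas : X + s • col w ∈ S.feasible := by
      change ∑ i, block (X + s • col w) i = ∑ i, S.d i
      simp only [hblock, Finset.sum_add_distrib, ← Finset.smul_sum, hw, smul_zero, add_zero]
      exact hX.1
    have h := isMinOn_iff.1 hX.2 _ hfeas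
    simp only [hblock] at h
    simpa using h
  have hder := HasDerivAt.fun_sum (u := Finset.univ)
    fun i _ => hasDerivAt_comp_add_smul (hf i) (block X i) (w i) 0
  simpa using hmin.hasDerivAt_eq_zero hder

/-! ### The closed loop as a cascade. -/

namespace AgentSystem

variable {N n : ℕ}

theorem norm_disagree_le (S : AgentSystem N n) {v : Fin N → Vec n} {D : ℝ}
    (hv : ∀ j, ‖v j‖ ≤ D) (i : Fin N) :
    ‖S.disagree v i‖ ≤ (∑ i, ∑ j, |S.a i j|) * (2 * D) := by
  have hD : 0 ≤ D := (norm_nonneg _).trans (hv i)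
  calc ‖S.disagree v i‖ ≤ ∑ j, |S.a i j| * (2 * D) := by
        refine norm_sum_le_of_le _ fun j _ => ?_
        rw [norm_smul, Real.norm_eq_abs]
        refine mul_le_mul_of_nonneg_left ?_ (abs_nonneg _)
        linarith [norm_sub_le (v i) (v j), hv i, hv j]
    _ = (∑ j, |S.a i j|) * (2 * D) := by rw [Finset.sum_mul]
    _ ≤ _ := by
        refine mul_le_mul_of_nonneg_right ?_ (by positivity)
        exact Finset.single_le_sum (f := fun i => ∑ j, |S.a i j|)
          (fun i _ => Finset.sum_nonneg fun j _ => abs_nonneg _) (Finset.mem_univ i)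

theorem disagree_sub (S : AgentSystem N n) (v w : Fin N → Vec n) (i : Fin N) :
    S.disagree (fun j => v j - w j) i = S.disagree v i - S.disagree w i := by
  simp only [disagree, ← Finset.sum_sub_distrib, ← smul_sub]
  exact Finset.sum_congr rfl fun j _ => by congr 1; abel

theorem hasDerivAt_disagree (S : AgentSystem N n) {v : Fin N → ℝ → Vec n} {v' : Fin N → Vec n}
    {t : ℝ} (hv : ∀ j, HasDerivAt (v j) (v' j) t) (i : Fin N) :
    HasDerivAt (fun s => S.disagree (fun j => v j s) i) (S.disagree v' i) t :=
  HasDerivAt.fun_sum fun j _ => ((hv i).sub (hv j)).const_smul (S.a i j)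

/-- The total perturbation of agent `i`: attack signals plus inherent dynamics. -/
noncomputable def perturbation (S : AgentSystem N n) (A : Attack N n) (T : Trajectory N n)
    (i : Fin N) (t : ℝ) : Stack 3 n :=
  col ![kappa1 A i t + S.g i (T.x i t), S.kappa2 A i t, S.kappa3 A i t]

/-- The time derivative of `perturbation`. -/
noncomputable def perturbationRate (S : AgentSystem N n) (A : Attack N n) (T : Trajectory N n)
    (i : Fin N) (t : ℝ) : Stack 3 n :=
  col ![derivWithin (A.u i) (Ici 0) t + derivWithin (fun s => S.g i (T.x i s)) (Ici 0) t,
    -S.disagree (fun j => derivWithin (A.lam j) (Ici 0) t) i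
      - S.disagree (fun j => derivWithin (A.z j) (Ici 0) t) i,
    S.disagree (fun j => derivWithin (A.lam j) (Ici 0) t) i]

/-- The drift enters only as a function of time, so no chain rule for `g` is needed. -/
theorem hasDerivAt_perturbation {S : AgentSystem N n} {A : Attack N n} {T : Trajectory N n}
    {D : ℝ} (hA : A.BoundedBy D) (hT : S.DriftRateBound T D) (i : Fin N) {t : ℝ} (ht : 0 < t) :
    HasDerivAt (S.perturbation A T i) (S.perturbationRate A T i t) t := by
  have hd : ∀ {s : ℝ → Vec n}, DifferentiableWithinAt ℝ s (Ici 0) t →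
      HasDerivAt s (derivWithin s (Ici 0) t) t := fun h =>
    h.hasDerivWithinAt.hasDerivAt (Ici_mem_nhds ht)
  have hu := hd ((hA i).1 t ht.le).1
  have hl := fun j => hd ((hA j).2.1 t ht.le).1
  have hz := fun j => hd ((hA j).2.2 t ht.le).1
  have hg := hd ((hT i).1 t ht.le)
  refine HasDerivAt.col fun b => ?_
  fin_cases b
  · exact hu.add hg
  · exact (S.hasDerivAt_disagree hl i).neg.sub (S.hasDerivAt_disagree hz i)
  · exact S.hasDerivAt_disagree hl i

/-- The first block contributes `2 * D` (attack and drift); the other two contain three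
disagreements. -/
theorem eventually_norm_perturbationRate_le {S : AgentSystem N n} {A : Attack N n}
    {T : Trajectory N n} {D : ℝ} (hA : A.BoundedBy D) (hT : S.DriftRateBound T D) (i : Fin N) :
    ∀ᶠ t in atTop,
      ‖S.perturbationRate A T i t‖ ≤ 2 * D + 3 * ((∑ i, ∑ j, |S.a i j|) * (2 * D)) := by
  filter_upwards [(hT i).2, eventually_ge_atTop 0] with t hg ht
  have hu := ((hA i).1 t ht).2.2
  have hl := S.norm_disagree_le (fun j => ((hA j).2.1 t ht).2.2) i
  have hz := S.norm_disagree_le (fun j => ((hA j).2.2 t ht).2.2) i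
  have h1 := norm_add_le (derivWithin (A.u i) (Ici 0) t)
    (derivWithin (fun s => S.g i (T.x i s)) (Ici 0) t)
  have h2 := norm_sub_le (-S.disagree (fun j => derivWithin (A.lam j) (Ici 0) t) i)
    (S.disagree (fun j => derivWithin (A.z j) (Ici 0) t) i)
  rw [norm_neg] at h2
  refine (norm_col_three_le _ _ _).trans ?_
  linarith

/-- The state derivative is perturbation plus known input, and the observer copies the known input,
so gradients and couplings cancel. -/
theorem hasDerivAt_innovation {S : AgentSystem N n} {A : Attack N n} {T : Trajectory N n}
    {h₁ h₂ : Stack 3 n → Stack 3 n} {w : ℝ} (hR : S.SolvesResilient A T)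
    (hO : S.SolvesESO h₁ h₂ w (w ^ 2) T) (i : Fin N) {t : ℝ} (ht : 0 < t) :
    HasDerivAt (innovation T i)
      (S.perturbation A T i t - T.kappaHat i t - w • h₁ (innovation T i t)) t := by
  obtain ⟨hx, hl, hz⟩ := hR i t ht.le
  have hγ : HasDerivAt (gamma T i) (S.perturbation A T i t + S.observerInput T i t) t := by
    have h := HasDerivAt.col (v := fun s => ![T.x i s, T.lam i s, T.z i s])
      (v' := ![S.g i (T.x i t) - gradient (S.f i) (T.x i t) - T.lam i t
        + kappa1 A i t - block (T.kappaHat i t) 0,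
        -S.disagree (fun j => T.lam j t) i - S.disagree (fun j => T.z j t) i
        + T.x i t - S.d i + S.kappa2 A i t - block (T.kappaHat i t) 1,
        S.disagree (fun j => T.lam j t) i + S.kappa3 A i t - block (T.kappaHat i t) 2])
      (t := t) (fun b => by
        fin_cases b
        · exact hx.hasDerivAt (Ici_mem_nhds ht)
        · exact hl.hasDerivAt (Ici_mem_nhds ht)
        · exact hz.hasDerivAt (Ici_mem_nhds ht))
    have e : S.perturbation A T i t + S.observerInput T i t
        = col ![S.g i (T.x i t) - gradient (S.f i) (T.x i t) - T.lam i t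
        + kappa1 A i t - block (T.kappaHat i t) 0,
        -S.disagree (fun j => T.lam j t) i - S.disagree (fun j => T.z j t) i
        + T.x i t - S.d i + S.kappa2 A i t - block (T.kappaHat i t) 1,
        S.disagree (fun j => T.lam j t) i + S.kappa3 A i t - block (T.kappaHat i t) 2] := by
      rw [perturbation, observerInput]
      change col (_ + _) = _
      congr 1
      funext b
      fin_cases b
      · change kappa1 A i t + S.g i (T.x i t) + (-gradient (S.f i) (T.x i t) - T.lam i t
          - block (T.kappaHat i t) 0) = S.g i (T.x i t) - gradient (S.f i) (T.x i t) - T.lam i t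
          + kappa1 A i t - block (T.kappaHat i t) 0
        abel
      · change S.kappa2 A i t + (-S.disagree (fun j => T.lam j t) i
          - S.disagree (fun j => T.z j t) i + T.x i t - S.d i - block (T.kappaHat i t) 1)
          = -S.disagree (fun j => T.lam j t) i - S.disagree (fun j => T.z j t) i
          + T.x i t - S.d i + S.kappa2 A i t - block (T.kappaHat i t) 1
        abel
      · change S.kappa3 A i t + (S.disagree (fun j => T.lam j t) i - block (T.kappaHat i t) 2)
          = S.disagree (fun j => T.lam j t) i + S.kappa3 A i t - block (T.kappaHat i t) 2
        abel
    rw [e]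
    exact h
  refine (hγ.sub ((hO i t ht.le).1.hasDerivAt (Ici_mem_nhds ht))).congr_deriv ?_
  abel

/-- The observer error is eventually `O(1 / w₀)`, uniformly in the attack and the initial data. -/
theorem exists_estimation_gain (S : AgentSystem N n) {h₁ h₂ : Stack 3 n → Stack 3 n}
    (hh : HasObserverLyapunov h₁ h₂) (D : ℝ) :
    ∃ K : ℝ, 0 < K ∧ ∀ w : ℝ, 0 < w → ∀ (A : Attack N n) (T : Trajectory N n),
      A.BoundedBy D → S.DriftRateBound T D →
      S.SolvesResilient A T → S.SolvesESO h₁ h₂ w (w ^ 2) T →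
      ∀ i, ∀ᶠ t in atTop, ‖S.perturbation A T i t - T.kappaHat i t‖ ≤ K / w := by
  obtain ⟨K, hK, hobs⟩ := exists_observer_gain hh
    -- Positive whatever the sign of `D`.
    (M := 1 + |2 * D + 3 * ((∑ i, ∑ j, |S.a i j|) * (2 * D))|) (by positivity)
  refine ⟨K, hK, fun w hw A T hA hT hR hO i => hobs w hw (innovation T i)
    (fun t => S.perturbation A T i t - T.kappaHat i t) (S.perturbationRate A T i) ?_ ?_ ?_⟩
  · filter_upwards [eventually_gt_atTop 0] with t ht
    exact hasDerivAt_innovation hR hO i ht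
  · filter_upwards [eventually_gt_atTop 0] with t ht
    exact (hasDerivAt_perturbation hA hT i ht).sub
      ((hO i t ht.le).2.hasDerivAt (Ici_mem_nhds ht))
  · filter_upwards [eventually_norm_perturbationRate_le hA hT i] with t ht
    linarith [le_abs_self (2 * D + 3 * ((∑ i, ∑ j, |S.a i j|) * (2 * D)))]

/-- The optimal allocation is an equilibrium: its stacked gradient is balanced, and the mismatch
of resources can be compensated by the auxiliary variable. -/
theorem IsOptimal.exists_equilibrium {S : AgentSystem N n} {G : SimpleGraph (Fin N)}
    (hG : G.Connected) (ha : IsWeighting G S.a) {X : Stack N n} (hX : S.IsOptimal X)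
    (hf : ∀ i, Differentiable ℝ (S.f i)) :
    (∀ i, S.disagree (fun j => -gradient (S.f j) (block X j)) i = 0) ∧
    ∃ z : Fin N → Vec n, ∀ i, S.disagree z i = block X i - S.d i := by
  constructor
  · let q : PiLp 2 (fun _ : Fin N => Vec n) :=
      WithLp.toLp 2 fun j => -gradient (S.f j) (block X j)
    -- Testing optimality in the zero-sum direction `L q` gives `⟨q, L q⟩ = 0`, hence `L q = 0`.
    have h := hX.sum_inner_gradient_eq_zero hf (w := fun i => laplacian S.a q i)
      (sum_laplacian ha.1 q)
    have h0 : inner ℝ q (laplacian S.a q) = 0 := by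
      rw [PiLp.inner_apply]
      simp only [q, inner_neg_left, Finset.sum_neg_distrib]
      rw [neg_eq_zero]
      exact h
    have h1 := laplacian_eq_zero_of_inner_self hG ha h0
    intro i
    exact congrArg (fun v : PiLp 2 (fun _ : Fin N => Vec n) => v i) h1
  · obtain ⟨z, hz⟩ := exists_laplacian_eq hG ha
      (WithLp.toLp 2 fun i => block X i - S.d i : PiLp 2 (fun _ : Fin N => Vec n)) (by
        have h : ∑ i, block X i = ∑ i, S.d i := hX.1
        simp [Finset.sum_sub_distrib, h])
    exact ⟨fun i => z i, fun i =>
      congrArg (fun v : PiLp 2 (fun _ : Fin N => Vec n) => v i) hz⟩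

/-- The closed loop in coordinates centred at an equilibrium, driven by the estimation errors. -/
theorem SolvesResilient.hasDerivAt_sub_equilibrium {S : AgentSystem N n} {A : Attack N n}
    {T : Trajectory N n} (hR : S.SolvesResilient A T) {xs ls zs : Fin N → Vec n}
    (hxs : ∀ i, ls i = -gradient (S.f i) (xs i)) (hls : ∀ i, S.disagree ls i = 0)
    (hzs : ∀ i, S.disagree zs i = xs i - S.d i) (i : Fin N) {t : ℝ} (ht : 0 < t) :
    HasDerivAt (fun s => T.x i s - xs i)
      (-(gradient (S.f i) (T.x i t) - gradient (S.f i) (xs i)) - (T.lam i t - ls i)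
        + block (S.perturbation A T i t - T.kappaHat i t) 0) t ∧
    HasDerivAt (fun s => T.lam i s - ls i)
      (-S.disagree (fun j => T.lam j t - ls j) i - S.disagree (fun j => T.z j t - zs j) i
        + (T.x i t - xs i) + block (S.perturbation A T i t - T.kappaHat i t) 1) t ∧
    HasDerivAt (fun s => T.z i s - zs i)
      (S.disagree (fun j => T.lam j t - ls j) i
        + block (S.perturbation A T i t - T.kappaHat i t) 2) t := by
  obtain ⟨hx, hl, hz⟩ := hR i t ht.le
  have b0 : block (S.perturbation A T i t - T.kappaHat i t) 0
      = kappa1 A i t + S.g i (T.x i t) - block (T.kappaHat i t) 0 := rfl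
  have b1 : block (S.perturbation A T i t - T.kappaHat i t) 1
      = S.kappa2 A i t - block (T.kappaHat i t) 1 := rfl
  have b2 : block (S.perturbation A T i t - T.kappaHat i t) 2
      = S.kappa3 A i t - block (T.kappaHat i t) 2 := rfl
  rw [b0, b1, b2, disagree_sub, disagree_sub, hls, hzs]
  refine ⟨((hx.hasDerivAt (Ici_mem_nhds ht)).sub_const (xs i)).congr_deriv ?_,
    ((hl.hasDerivAt (Ici_mem_nhds ht)).sub_const (ls i)).congr_deriv ?_,
    ((hz.hasDerivAt (Ici_mem_nhds ht)).sub_const (zs i)).congr_deriv ?_⟩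
  · rw [hxs]; abel
  · abel
  · abel

/-- If all observers eventually have error at most `ρ`, the allocation error is eventually at most
a multiple of `ρ`. -/
theorem exists_allocation_gain {S : AgentSystem N n} {G : SimpleGraph (Fin N)}
    (hG : G.Connected) (ha : IsWeighting G S.a) {l : ℝ≥0} (hf : ∀ i, IsRegularCost l (S.f i))
    {X : Stack N n} (hX : S.IsOptimal X) :
    ∃ K : ℝ, 0 < K ∧ ∀ (A : Attack N n) (T : Trajectory N n) (ρ : ℝ), 0 < ρ →
      S.SolvesResilient A T →
      (∀ i, ∀ᶠ t in atTop, ‖S.perturbation A T i t - T.kappaHat i t‖ ≤ ρ) →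
      ∀ᶠ t in atTop, allocationError T X t ≤ K * ρ := by
  have hne : Nonempty (Fin N) := hG.nonempty
  have hdiff : ∀ i, Differentiable ℝ (S.f i) := fun i => (hf i).1.differentiable one_ne_zero
  obtain ⟨hlam, zs, hzs⟩ := hX.exists_equilibrium hG ha hdiff
  choose m hm hmc using fun i => (hf i).2.1
  obtain ⟨i₀, hi₀⟩ := Finite.exists_min m
  obtain ⟨K, hK, hgain⟩ := exists_saddle_gain
    -- The smallest of the moduli of strong convexity serves all agents; the Lipschitz constant `l`
    -- bounds the gradient increments.
    (laplacian S.a : PiLp 2 (fun _ : Fin N => Vec n) →L[ℝ] _)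
    (inner_laplacian_left ha.1) (inner_laplacian_self_nonneg ha)
    (fun x => laplacian_eq_zero_of_inner_self hG ha) (hm i₀) (k := l)
  have hN : 0 < N := Fin.pos i₀
  refine ⟨K * N, by positivity, fun A T ρ hρ hR he => ?_⟩
  let e : ℝ → Fin N → Stack 3 n := fun t i => S.perturbation A T i t - T.kappaHat i t
  let eb : Fin 3 → ℝ → PiLp 2 (fun _ : Fin N => Vec n) := fun b t =>
    WithLp.toLp 2 fun i => block (e t i) b
  -- Stacking `N` errors of size `ρ` costs at most a factor `N`, which reappears in the gain.
  have heb : ∀ᶠ t in atTop, ∀ b, ‖eb b t‖ ≤ N * ρ := by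
    filter_upwards [eventually_all.2 he] with t ht b
    calc ‖eb b t‖ ≤ ∑ i, ‖block (e t i) b‖ := PiLp.norm_le_sum_norm _
      _ ≤ ∑ _i : Fin N, ρ := Finset.sum_le_sum fun i _ => (norm_block_le _ _).trans (ht i)
      _ = N * ρ := by simp
  have heq := fun i t ht => hR.hasDerivAt_sub_equilibrium (fun _ => rfl) hlam hzs i (t := t) ht
  have hres := hgain (fun t => WithLp.toLp 2 fun i => T.x i t - block X i)
    (fun t => WithLp.toLp 2 fun i => T.lam i t - -gradient (S.f i) (block X i))
    (fun t => WithLp.toLp 2 fun i => T.z i t - zs i)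
    (fun t => WithLp.toLp 2 fun i => gradient (S.f i) (T.x i t) - gradient (S.f i) (block X i))
    (eb 0) (eb 1) (eb 2) (N * ρ) (by positivity) ?_ ?_ ?_ ?_ ?_
  · filter_upwards [hres] with t ht
    calc allocationError T X t = _ := norm_col fun i => T.x i t - block X i
      _ ≤ K * (N * ρ) := ht
      _ = K * N * ρ := by ring
  · filter_upwards [eventually_gt_atTop 0] with t ht
    exact HasDerivAt.toLp_pi fun i => (heq i t ht).1
  · filter_upwards [eventually_gt_atTop 0] with t ht
    exact HasDerivAt.toLp_pi fun i => (heq i t ht).2.1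
  · filter_upwards [eventually_gt_atTop 0] with t ht
    exact HasDerivAt.toLp_pi fun i => (heq i t ht).2.2
  · refine Eventually.of_forall fun t => ⟨?_, PiLp.norm_le_mul_norm l.coe_nonneg fun i => ?_⟩
    · rw [PiLp.norm_sq_eq_of_L2, PiLp.inner_apply, Finset.mul_sum]
      refine Finset.sum_le_sum fun i _ => ?_
      exact (mul_le_mul_of_nonneg_right (hi₀ i) (sq_nonneg _)).trans
        ((hmc i).mul_sq_norm_sub_le_inner_gradient (hdiff i) (T.x i t) (block X i))
    · exact (hf i).2.2.norm_sub_le (T.x i t) (block X i)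
  · filter_upwards [heb] with t ht
    exact ⟨ht 0, ht 1, ht 2⟩

end AgentSystem

theorem mainTheorem3 {N n : ℕ} (S : AgentSystem N n)
    (G : SimpleGraph (Fin N)) (hG : G.Connected) (ha : IsWeighting G S.a)
    (l : ℝ≥0) (hf : ∀ i, IsRegularCost l (S.f i))
    (Xstar : Stack N n) (hX : S.IsOptimal Xstar)
    (h₁ h₂ : Stack 3 n → Stack 3 n) (hh : HasObserverLyapunov h₁ h₂) (D : ℝ) :
    ∃ C : ℝ, ∀ w₀ : ℝ, 0 < w₀ → ∀ (A : Attack N n) (T : Trajectory N n),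
      A.BoundedBy D → S.DriftRateBound T D →
      S.SolvesResilient A T → S.SolvesESO h₁ h₂ w₀ (w₀ ^ 2) T →
        IsBoundedUnder (· ≤ ·) atTop (allocationError T Xstar) ∧
        limsup (allocationError T Xstar) atTop ≤ C / w₀ := by
  obtain ⟨K₁, hK₁, hest⟩ := S.exists_estimation_gain hh D
  obtain ⟨K₂, -, halloc⟩ := AgentSystem.exists_allocation_gain hG ha hf hX
  refine ⟨K₂ * K₁, fun w₀ hw A T hA hT hR hO => ?_⟩
  have h := halloc A T (K₁ / w₀) (by positivity) hR (hest w₀ hw A T hA hT hR hO)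
  rw [← mul_div_assoc] at h
  -- A real `limsup` is bounded by an eventual upper bound only with coboundedness, here from
  -- nonnegativity of the norm.
  have hco : IsCoboundedUnder (· ≤ ·) atTop (allocationError T Xstar) :=
    IsBoundedUnder.isCoboundedUnder_le
      (isBoundedUnder_of_eventually_ge (Eventually.of_forall fun t => norm_nonneg _))
  exact ⟨isBoundedUnder_of_eventually_le h, limsup_le_of_le hco h⟩
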